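/- **Machines.** All Turing machines here are nondeterministic and have finitely many states, one read/write head, and one tape with cells $0,1,2,\dots$ (infinite in one direction; a left move at cell $0$ leaves the head there). In each step the machine may move its head one cell left or right or leave it in place. Each cell is blank ($0$) or marked ($1$). A machine is *write-once* if it never writes a blank to a marked cell (marking a marked cell again is allowed). An input word over $\{0,1\}$ is presented at the left end of an otherwise blank tape with each letter encoded in two cells, $0\mapsto 10$ and $1\mapsto 01$, and the head starts at cell $0$. A word is accepted if some run on it reaches an accepting state. A machine works in time (respectively space) $f$ if every accepted word of length $n$ has an accepting run with at most $f(n)$ steps (respectively visiting only the first $f(n)$ cells). **Classes.** Let $\exp_0(x)=x$ and $\exp_{k+1}(x)=2^{\exp_k(x)}$. Let $k\text{-NExpTime}$ be the class of languages $L\subseteq\{0,1\}^*$ accepted by a nondeterministic Turing machine in time $O(\exp_k(n^t))$ for some $t\in\mathbb N$, and $k\text{-NExpWOSpace}$ the class of those accepted by a nondeterministic write-once Turing machine in space $O(\exp_k(n^t))$ for some $t\in\mathbb N$. **Theorem.** For every $k\in\mathbb N$, $$k\text{-NExpTime} = k\text{-NExpWOSpace}.$$ -/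

import Mathlib

/-- Direction of a head move. -/
inductive Move where
  | left
  | stay
  | right

/-- New head position on a tape whose cells are numbered `0, 1, 2, …`; a left move at the leftmost
cell `0` leaves the head there. -/
def Move.apply : Move → ℕ → ℕ
  | .left, i => i - 1
  | .stay, i => i
  | .right, i => i + 1

/-- A nondeterministic Turing machine with finitely many states, one tape, one read/write head, and
the two tape symbols `false` (blank, `0`) and `true` (marked, `1`).  The tape is infinite in one
direction only.  `(p, b, m) ∈ δ q a` means: in state `q`, reading `a`, the machine may write `b`,
move by `m` and enter state `p`. -/
structure NTM where
  State : Type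
  finite_state : Finite State
  start : State
  accept : Set State
  δ : State → Bool → Set (State × Bool × Move)

namespace NTM

/-- A write-once machine never writes a blank to a marked cell.  (Marking a marked cell again is
allowed.) -/
def WriteOnce (M : NTM) : Prop :=
  ∀ q p m, (p, false, m) ∉ M.δ q true

/-- A configuration: state, head position, tape contents. -/
structure Cfg (M : NTM) where
  state : M.State
  head : ℕ
  tape : ℕ → Bool

/-- One computation step. -/
def Step (M : NTM) (c d : M.Cfg) : Prop :=
  ∃ b m, (d.state, b, m) ∈ M.δ c.state (c.tape c.head) ∧
    d.head = m.apply c.head ∧ d.tape = Function.update c.tape c.head b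

/-- The encoding of an input word in tape symbols: the letter `0` is written as the two cells `10`
and the letter `1` as the two cells `01`; so `00` (two blank cells) ends the input, and
every letter can be crossed out to `11` by a write-once machine. -/
def encode (w : List Bool) : List Bool :=
  w.flatMap fun b => [!b, b]

/-- Initial configuration: the encoded input at the left end of an otherwise blank tape, and the
head on the leftmost cell. -/
def init (M : NTM) (w : List Bool) : M.Cfg where
  state := M.start
  head := 0
  tape := fun i => (encode w).getD i false

/-- `run 0, …, run n` is an accepting run of `M` on `w`, with `n` steps: it stops in an accepting
state. -/
def IsAcceptingRun (M : NTM) (w : List Bool) (n : ℕ) (run : ℕ → M.Cfg) : Prop :=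
  run 0 = M.init w ∧ (∀ i < n, M.Step (run i) (run (i + 1))) ∧ (run n).state ∈ M.accept

/-- `M` accepts `w` if some run on `w` is accepting. -/
def Accepts (M : NTM) (w : List Bool) : Prop :=
  ∃ n run, M.IsAcceptingRun w n run

/-- Some accepting run on `w` has at most `T` steps. -/
def AcceptsInTime (M : NTM) (w : List Bool) (T : ℕ) : Prop :=
  ∃ n run, M.IsAcceptingRun w n run ∧ n ≤ T

/-- Some accepting run on `w` visits only the first `S` cells of the tape. -/
def AcceptsInSpace (M : NTM) (w : List Bool) (S : ℕ) : Prop :=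
  ∃ n run, M.IsAcceptingRun w n run ∧ ∀ i ≤ n, (run i).head < S

/-- `M` accepts exactly the words of `L`. -/
def Recognizes (M : NTM) (L : Language Bool) : Prop :=
  ∀ w, w ∈ L ↔ M.Accepts w

end NTM

/-- Languages of nondeterministic Turing machines with time bound `f`: every accepted word of
length `n` has an accepting run of at most `f n` steps. -/
def NTime (f : ℕ → ℕ) : Set (Language Bool) :=
  {L | ∃ M : NTM, M.Recognizes L ∧ ∀ w ∈ L, M.AcceptsInTime w (f w.length)}

/-- Languages of nondeterministic write-once Turing machines with space bound `f`: every accepted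
word of length `n` has an accepting run using at most `f n` cells. -/
def NWOSpace (f : ℕ → ℕ) : Set (Language Bool) :=
  {L | ∃ M : NTM, M.WriteOnce ∧ M.Recognizes L ∧ ∀ w ∈ L, M.AcceptsInSpace w (f w.length)}

/-- The `k`-fold iterated exponential: `kexp 0 x = x` and `kexp (k + 1) x = 2 ^ kexp k x`. -/
def kexp : ℕ → ℕ → ℕ
  | 0, x => x
  | k + 1, x => 2 ^ kexp k x

/-- `k-NExpTime`: nondeterministic time `O(kexp k (n ^ t))` for some exponent `t`. -/
def kNExpTime (k : ℕ) : Set (Language Bool) :=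
  ⋃ (t : ℕ) (C : ℕ), NTime fun n => C * kexp k (n ^ t) + C

/-- `k-NExpWOSpace`: nondeterministic write-once space `O(kexp k (n ^ t))` for some exponent
`t`. -/
def kNExpWOSpace (k : ℕ) : Set (Language Bool) :=
  ⋃ (t : ℕ) (C : ℕ), NWOSpace fun n => C * kexp k (n ^ t) + C

/-! ### Runs as reflexive transitive closures -/

/-! From space to time: a write-once run only gains marks, so two of its configurations with the
same state, head position and number of marks coincide (`NTM.WriteOnce.cfg_eq`). A shortest
accepting run within `S` cells repeats no configuration, hence has at most `|Q| * S * (S + 1)` steps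
(`NTM.WriteOnce.acceptsInTime`). The bounds are closed under squaring (`exists_kexp_bound`), so the
same machine serves.

From time to space: a write-once tape can hold a queue. Over pairs of bits, `00` is unused space,
`10` and `01` are queue letters, and `11` is a removed letter, so each pair only ever gains marks.
The space used is the input plus all bits ever appended, and running time is irrelevant
(`QueueMachine.Accepts.toNTM`). It remains to simulate `T` steps by a queue machine that appends
`O((T + n)^2)` bits. The queue holds a configuration as a cyclic word of length `O(T + n)`. A step
of the machine rewrites this word locally, and rotating the queue brings the place of the rewriting
to the front (`NTM.accepts_main`).

The delicate point is the input: it is raw bits, without an end marker that the queue machine could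
recognise. The end is guessed, with a separator `fence` appended behind the input. Guessing too late
leaves a queue that never begins with the fence (`not_dead_fence_append`). Guessing too early leaves
an aligned block `111`, which no later rule can remove, while acceptance requires an empty queue
(`bad_of_fence_append_eq`). Soundness of all guesses together is `NTM.sound_of_accepts`. -/

open Relation in
theorem reflTransGen_iff_exists_run {α : Type*} {r : α → α → Prop} {a b : α} :
    ReflTransGen r a b ↔
      ∃ (n : ℕ) (f : ℕ → α), f 0 = a ∧ f n = b ∧ ∀ i < n, r (f i) (f (i + 1)) := by
  constructor
  · intro h
    induction h with
    | refl => exact ⟨0, fun _ => a, rfl, rfl, by simp⟩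
    | @tail b c _ hbc ih =>
      obtain ⟨n, f, h0, hn, hf⟩ := ih
      refine ⟨n + 1, fun i => if i ≤ n then f i else c, by simp [h0], by simp, fun i hi => ?_⟩
      rcases Nat.lt_succ_iff_lt_or_eq.1 hi with h | rfl
      · simpa [h.le, Nat.succ_le_of_lt h] using hf i h
      · simpa [hn] using hbc
  · rintro ⟨n, f, rfl, rfl, hf⟩
    have : ∀ i ≤ n, ReflTransGen r (f 0) (f i) := by
      intro i
      induction i with
      | zero => intro _; exact .refl
      | succ i ih => intro hi; exact (ih (by omega)).tail (hf i (by omega))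
    exact this n le_rfl

namespace NTM

/-- Some accepting state can be reached from `c`. -/
def AcceptsFrom (M : NTM) (c : M.Cfg) : Prop :=
  ∃ d, Relation.ReflTransGen M.Step c d ∧ d.state ∈ M.accept

/-- A step between configurations whose heads are on the first `S` cells. -/
def StepWithin (M : NTM) (S : ℕ) (c d : M.Cfg) : Prop :=
  M.Step c d ∧ c.head < S ∧ d.head < S

theorem accepts_iff_acceptsFrom {M : NTM} {w : List Bool} :
    M.Accepts w ↔ M.AcceptsFrom (M.init w) := by
  constructor
  · rintro ⟨n, f, h0, hf, hn⟩
    exact ⟨f n, reflTransGen_iff_exists_run.2 ⟨n, f, h0, rfl, hf⟩, hn⟩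
  · rintro ⟨d, h, hd⟩
    obtain ⟨n, f, h0, rfl, hf⟩ := reflTransGen_iff_exists_run.1 h
    exact ⟨n, f, h0, hf, hd⟩

theorem AcceptsFrom.head {M : NTM} {c d : M.Cfg} (hd : M.AcceptsFrom d) (h : M.Step c d) :
    M.AcceptsFrom c :=
  let ⟨e, he, ha⟩ := hd
  ⟨e, .head h he, ha⟩

theorem acceptsInSpace_of_reflTransGen {M : NTM} {w : List Bool} {S : ℕ} {d : M.Cfg} (hS : 0 < S)
    (h : Relation.ReflTransGen (M.StepWithin S) (M.init w) d) (hd : d.state ∈ M.accept) :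
    M.AcceptsInSpace w S := by
  obtain ⟨n, f, h0, rfl, hf⟩ := reflTransGen_iff_exists_run.1 h
  refine ⟨n, f, ⟨h0, fun i hi => (hf i hi).1, hd⟩, fun i hi => ?_⟩
  -- A run without steps says nothing about its head, so time `0` needs `hS`.
  rcases i with _ | i
  · rw [h0]; exact hS
  · exact (hf i hi).2.2

theorem AcceptsInSpace.accepts {M : NTM} {w : List Bool} {S : ℕ} (h : M.AcceptsInSpace w S) :
    M.Accepts w :=
  let ⟨n, f, hf, _⟩ := h
  ⟨n, f, hf⟩

/-! ### Write-once machines: from space to time -/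

theorem WriteOnce.tape_mono {M : NTM} (hM : M.WriteOnce) {c d : M.Cfg} (h : M.Step c d) :
    c.tape ≤ d.tape := by
  obtain ⟨b, m, hδ, -, ht⟩ := h
  rw [ht]
  intro i
  by_cases hi : i = c.head
  · subst hi
    rw [Function.update_self]
    cases b
    · cases hc : c.tape c.head
      · exact le_rfl
      · rw [hc] at hδ
        exact absurd hδ (hM _ _ _)
    · exact Bool.le_true _
  · rw [Function.update_of_ne hi]

/-- Two repeated (state, head, number of marks) triples on a run of a write-once machine belong to
the same configuration. -/
theorem WriteOnce.cfg_eq {M : NTM} (hM : M.WriteOnce) {f : ℕ → M.Cfg} {n S : ℕ}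
    (hf : ∀ i < n, M.Step (f i) (f (i + 1))) (hS : ∀ i ≤ n, (f i).head < S) {i j : ℕ}
    (hij : i ≤ j) (hj : j ≤ n) (hstate : (f i).state = (f j).state)
    (hhead : (f i).head = (f j).head)
    (hcard : ((Finset.range S).filter fun x => (f i).tape x = true).card =
      ((Finset.range S).filter fun x => (f j).tape x = true).card) : f i = f j := by
  have key : ∀ k, i ≤ k → k ≤ n →
      (f i).tape ≤ (f k).tape ∧ ∀ x, S ≤ x → (f i).tape x = (f k).tape x := by
    intro k hk
    induction k, hk using Nat.le_induction with
    | base => exact fun _ => ⟨le_rfl, fun _ _ => rfl⟩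
    | succ k hk ih =>
      intro hkn
      obtain ⟨h1, h2⟩ := ih (by omega)
      refine ⟨h1.trans (hM.tape_mono (hf k (by omega))), fun x hx => ?_⟩
      obtain ⟨b, m, -, -, ht⟩ := hf k (by omega)
      rw [h2 x hx, ht, Function.update_of_ne]
      have := hS k (by omega)
      omega
  obtain ⟨h1, h2⟩ := key j hij hj
  have hsub : ((Finset.range S).filter fun x => (f i).tape x = true) ⊆
      (Finset.range S).filter fun x => (f j).tape x = true := by
    intro x hx
    rw [Finset.mem_filter] at hx ⊢
    refine ⟨hx.1, ?_⟩
    have := h1 x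
    rw [hx.2] at this
    exact top_le_iff.1 this
  -- The sets of marks are nested, so equal cardinality makes them equal.
  have heq := Finset.eq_of_subset_of_card_le hsub hcard.ge
  have htape : (f i).tape = (f j).tape := by
    funext x
    rcases lt_or_ge x S with hx | hx
    · have := congrArg (x ∈ ·) heq
      simp only [Finset.mem_filter, Finset.mem_range, hx, true_and, eq_iff_iff] at this
      exact Bool.eq_iff_iff.2 this
    · exact h2 x hx
  cases hi : f i
  cases hj' : f j
  simp_all

/-- Along a shortest accepting run the triples of `cfg_eq` are pairwise distinct; the bound counts
them, the number of marks ranging over `0, …, S`. -/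
theorem WriteOnce.acceptsInTime {M : NTM} (hM : M.WriteOnce) {w : List Bool} {S : ℕ}
    (h : M.AcceptsInSpace w S) : M.AcceptsInTime w (Nat.card M.State * (S * (S + 1))) := by
  classical
  have := M.finite_state
  have := Fintype.ofFinite M.State
  have hex : ∃ n, ∃ f, M.IsAcceptingRun w n f ∧ ∀ i ≤ n, (f i).head < S := h
  set n := Nat.find hex with hn
  obtain ⟨f, ⟨h0, hf, hacc⟩, hS⟩ := Nat.find_spec hex
  refine ⟨n, f, ⟨h0, hf, hacc⟩, ?_⟩
  have hne : ∀ i j, i < j → j ≤ n → f i ≠ f j := by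
    intro i j hij hj hfij
    have hlt : n - (j - i) < n := by omega
    -- Cutting out the loop between times `i` and `j` gives a shorter run.
    refine Nat.find_min hex hlt ⟨fun k => if k ≤ i then f k else f (k + (j - i)), ⟨by simp [h0], ?_, ?_⟩, ?_⟩
    · intro k hk
      rcases lt_trichotomy k i with h | rfl | h
      · simpa [h.le, Nat.succ_le_of_lt h] using hf k (by omega)
      · have := hf j (by omega)
        rw [← hfij] at this
        have e : k + 1 + (j - k) = j + 1 := by omega
        simpa [e] using this
      · have e : k + 1 + (j - i) = k + (j - i) + 1 := by omega
        have := hf (k + (j - i)) (by omega)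
        simpa [e, show ¬ k ≤ i by omega, show ¬ k + 1 ≤ i by omega] using this
    · by_cases h : n - (j - i) ≤ i
      · have e1 : n - (j - i) = i := by omega
        have e2 : n = j := by omega
        simp only [e1, le_refl, if_true, hfij]
        rwa [← e2]
      · have e : n - (j - i) + (j - i) = n := by omega
        simp only [h, if_false, e]
        exact hacc
    · intro k hk
      dsimp only
      split_ifs
      · exact hS k (by omega)
      · exact hS _ (by omega)
  let g : ℕ → M.State × ℕ × ℕ := fun i =>
    ((f i).state, (f i).head, ((Finset.range S).filter fun x => (f i).tape x = true).card)
  have hmaps : ∀ i ∈ Finset.range (n + 1), g i ∈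
      (Finset.univ : Finset M.State) ×ˢ (Finset.range S ×ˢ Finset.range (S + 1)) := by
    intro i hi
    have hi' : i ≤ n := by simpa [Nat.lt_succ_iff] using hi
    simp only [g, Finset.mem_product, Finset.mem_univ, Finset.mem_range, true_and]
    refine ⟨hS i hi', Nat.lt_succ_of_le ((Finset.card_filter_le _ _).trans_eq (Finset.card_range S))⟩
  have hinj : Set.InjOn g (Finset.range (n + 1)) := by
    intro i hi j hj hij
    simp only [Finset.coe_range, Set.mem_Iio] at hi hj
    simp only [g, Prod.mk.injEq] at hij
    obtain ⟨e1, e2, e3⟩ := hij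
    rcases lt_trichotomy i j with h | h | h
    · exact absurd (hM.cfg_eq hf hS h.le (by omega) e1 e2 e3) (hne i j h (by omega))
    · exact h
    · exact absurd (hM.cfg_eq hf hS h.le (by omega) e1.symm e2.symm e3.symm)
        (hne j i h (by omega))
  have hcard := Finset.card_le_card_of_injOn g hmaps hinj
  rw [Finset.card_range, Finset.card_product, Finset.card_product, Finset.card_range,
    Finset.card_range, Finset.card_univ, ← Nat.card_eq_fintype_card] at hcard
  omega

end NTM

/-! ### Growth of iterated exponentials -/

theorem le_kexp (k x : ℕ) : x ≤ kexp k x := by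
  induction k with
  | zero => exact le_rfl
  | succ k ih => exact ih.trans Nat.lt_two_pow_self.le

theorem kexp_mono (k : ℕ) : Monotone (kexp k) := by
  induction k with
  | zero => exact monotone_id
  | succ k ih => exact fun x y h => Nat.pow_le_pow_right two_pos (ih h)

/-- Squaring a power of two doubles its exponent, and `2 * y ≤ y ^ 2` once `2 ≤ y`. -/
theorem kexp_sq_le {k x : ℕ} (hx : 2 ≤ x) : kexp k x ^ 2 ≤ kexp k (x ^ 2) := by
  induction k with
  | zero => exact le_rfl
  | succ k ih =>
    have h2 : 2 ≤ kexp k x := hx.trans (le_kexp k x)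
    calc (2 ^ kexp k x) ^ 2 = 2 ^ (kexp k x * 2) := (pow_mul _ _ _).symm
      _ ≤ 2 ^ kexp k (x ^ 2) := Nat.pow_le_pow_right two_pos (by nlinarith)

/-- The additive constant pays for `x ≤ 1`, where squaring the argument gains nothing. -/
theorem kexp_sq_le_add (k x : ℕ) : kexp k x ^ 2 ≤ kexp k (x ^ 2) + kexp k 1 ^ 2 := by
  rcases le_or_gt 2 x with hx | hx
  · exact (kexp_sq_le hx).trans (Nat.le_add_right _ _)
  · exact (Nat.pow_le_pow_left (kexp_mono k (by omega)) 2).trans (Nat.le_add_left _ _)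

theorem kexp_pow_le_add (k n t : ℕ) : kexp k (n ^ t) ≤ kexp k (n ^ (t + 1)) + kexp k 1 := by
  rcases Nat.eq_zero_or_pos n with rfl | hn
  -- Monotonicity in the exponent fails at `0 ^ 0 = 1`; the extra summand covers this.
  · have : 0 ^ t ≤ 1 := by rcases t with _ | t <;> simp
    exact (kexp_mono k this).trans (Nat.le_add_left _ _)
  · exact (kexp_mono k (Nat.pow_le_pow_right hn (Nat.le_succ t))).trans (Nat.le_add_right _ _)

/-- The bounds `O(kexp k (n ^ t))` are closed under squaring and adding the word length. -/
theorem exists_kexp_bound (k t C c : ℕ) :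
    ∃ t' C', ∀ n, c * (C * kexp k (n ^ t) + C + n + 1) ^ 2 ≤ C' * kexp k (n ^ t') + C' := by
  -- Exponent `t + 1` lets the power dominate `n` even for `t = 0`; the factor `2` absorbs the
  -- square.
  refine ⟨(t + 1) * 2, c * (2 * (C * kexp k 1 + 2 * C + 2) ^ 2 * (1 + kexp k 1 ^ 2)), fun n => ?_⟩
  set X := kexp k (n ^ (t + 1)) with hX
  set Y := kexp k (n ^ ((t + 1) * 2)) with hY
  set e := kexp k 1
  have h1 : kexp k (n ^ t) ≤ X + e := kexp_pow_le_add k n t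
  have h2 : X ^ 2 ≤ Y + e ^ 2 := by
    rw [hY, pow_mul]; exact kexp_sq_le_add k _
  have h3 : n ≤ X := (Nat.le_self_pow (Nat.succ_ne_zero t) n).trans (le_kexp k _)
  set D := C * e + 2 * C + 2 with hD
  have h4 : C * kexp k (n ^ t) + C + n + 1 ≤ D * (X + 1) := by
    have := Nat.mul_le_mul_left C h1
    nlinarith [Nat.zero_le (C * e * X), Nat.zero_le (C * X)]
  calc c * (C * kexp k (n ^ t) + C + n + 1) ^ 2 ≤ c * (D * (X + 1)) ^ 2 := by gcongr
    _ ≤ c * (2 * D ^ 2 * (X ^ 2 + 1)) := by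
      gcongr
      have : (X + 1) ^ 2 ≤ 2 * (X ^ 2 + 1) := by
        zify
        nlinarith [sq_nonneg ((X : ℤ) - 1)]
      calc (D * (X + 1)) ^ 2 = D ^ 2 * (X + 1) ^ 2 := mul_pow _ _ _
        _ ≤ D ^ 2 * (2 * (X ^ 2 + 1)) := by gcongr
        _ = _ := by ring
    _ ≤ c * (2 * D ^ 2 * ((1 + e ^ 2) * Y + (1 + e ^ 2))) := by
      refine Nat.mul_le_mul_left _ (Nat.mul_le_mul_left _ ?_)
      nlinarith [Nat.zero_le (e ^ 2 * Y)]
    _ = _ := by ring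

theorem kNExpWOSpace_subset_kNExpTime (k : ℕ) : kNExpWOSpace k ⊆ kNExpTime k := by
  intro L hL
  simp only [kNExpWOSpace, Set.mem_iUnion] at hL
  obtain ⟨t, C, M, hM, hrec, hS⟩ := hL
  obtain ⟨t', C', h⟩ := exists_kexp_bound k t C (Nat.card M.State)
  simp only [kNExpTime, Set.mem_iUnion]
  refine ⟨t', C', M, hrec, fun w hw => ?_⟩
  obtain ⟨n, f, hf, hn⟩ := hM.acceptsInTime (hS w hw)
  refine ⟨n, f, hf, hn.trans (le_trans ?_ (h w.length))⟩
  refine Nat.mul_le_mul_left _ ?_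
  dsimp only
  generalize C * kexp k (w.length ^ t) + C = S
  nlinarith [Nat.zero_le (S * w.length)]

/-! ### Machines with pairs of bits as tape symbols -/

instance Move.instFinite : Finite Move :=
  Finite.of_injective (fun m : Move => match m with
    | .left => (0 : Fin 3)
    | .stay => 1
    | .right => 2) (by intro a b h; cases a <;> cases b <;> simp_all)

/-- A nondeterministic Turing machine whose tape symbols are pairs of bits. -/
structure PairTM where
  State : Type
  finite_state : Finite State
  start : State
  accept : Set State
  δ : State → Bool × Bool → Set (State × (Bool × Bool) × Move)

namespace PairTM

/-- No bit of a tape symbol is ever erased. -/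
def WriteOnce (P : PairTM) : Prop :=
  ∀ q a p a' m, (p, a', m) ∈ P.δ q a → a ≤ a'

structure Cfg (P : PairTM) where
  state : P.State
  head : ℕ
  tape : ℕ → Bool × Bool

def Step (P : PairTM) (c d : P.Cfg) : Prop :=
  ∃ a m, (d.state, a, m) ∈ P.δ c.state (c.tape c.head) ∧
    d.head = m.apply c.head ∧ d.tape = Function.update c.tape c.head a

/-- A step between configurations whose heads are on the first `S` cells. -/
def StepWithin (P : PairTM) (S : ℕ) (c d : P.Cfg) : Prop :=
  P.Step c d ∧ c.head < S ∧ d.head < S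

/-- The tape holding the letters of `w`, encoded by `10` and `01`, followed by blanks. -/
def letterTape (w : List Bool) (i : ℕ) : Bool × Bool :=
  (w[i]?.map fun b => (!b, b)).getD (false, false)

def init (P : PairTM) (w : List Bool) : P.Cfg where
  state := P.start
  head := 0
  tape := letterTape w

/-- Writing each tape symbol into two consecutive cells. -/
def join (τ : ℕ → Bool × Bool) (i : ℕ) : Bool :=
  if i % 2 = 0 then (τ (i / 2)).1 else (τ (i / 2)).2

theorem join_two_mul (τ : ℕ → Bool × Bool) (h : ℕ) : join τ (2 * h) = (τ h).1 := by
  simp [join]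

theorem join_two_mul_add_one (τ : ℕ → Bool × Bool) (h : ℕ) : join τ (2 * h + 1) = (τ h).2 := by
  have h1 : (2 * h + 1) % 2 = 1 := by omega
  have h2 : (2 * h + 1) / 2 = h := by omega
  simp [join, h1, h2]

theorem join_update (τ : ℕ → Bool × Bool) (h : ℕ) (x y : Bool) :
    Function.update (Function.update (join τ) (2 * h + 1) y) (2 * h) x =
      join (Function.update τ h (x, y)) := by
  funext i
  obtain ⟨j, rfl | rfl⟩ := Nat.even_or_odd' i
  · rw [join_two_mul]
    by_cases hj : j = h
    · subst hj; simp
    · rw [Function.update_of_ne (by omega), Function.update_of_ne (by omega),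
        Function.update_of_ne hj, join_two_mul]
  · rw [join_two_mul_add_one, Function.update_of_ne (by omega)]
    by_cases hj : j = h
    · subst hj; simp
    · rw [Function.update_of_ne (by omega), Function.update_of_ne hj, join_two_mul_add_one]

theorem join_letterTape (w : List Bool) :
    join (letterTape w) = fun i => (NTM.encode w).getD i false := by
  induction w with
  | nil => funext i; simp [join, letterTape, NTM.encode]
  | cons b w ih =>
    have e : NTM.encode (b :: w) = (!b) :: b :: NTM.encode w := by simp [NTM.encode]
    funext i
    rw [e]
    rcases i with _ | _ | i
    · simp [join, letterTape]
    · simp [join, letterTape]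
    · have := congrFun ih i
      simp only [List.getD_cons_succ]
      rw [← this]
      simp [join, letterTape, show (i + 1 + 1) / 2 = i / 2 + 1 by omega,
        show (i + 1 + 1) % 2 = i % 2 by omega]

/-! ### Simulating pairs of bits by single bits -/

/-- Control states of the bit machine that performs one step on pairs in four steps on bits: read
both bits, write both bits back in reverse order, and make the move twice. -/
inductive SplitState (Q : Type) where
  | fst (q : Q)
  | snd (q : Q) (x : Bool)
  | back (p : Q) (x : Bool) (m : Move)
  | go (p : Q) (m : Move)

instance SplitState.instFinite (Q : Type) [Finite Q] : Finite (SplitState Q) :=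
  Finite.of_injective (β := Q ⊕ (Q × Bool) ⊕ (Q × Bool × Move) ⊕ (Q × Move))
    (fun s => match s with
      | .fst q => .inl q
      | .snd q x => .inr (.inl (q, x))
      | .back p x m => .inr (.inr (.inl (p, x, m)))
      | .go p m => .inr (.inr (.inr (p, m))))
    (by intro a b h; cases a <;> cases b <;> simp_all)

/-- The transitions of the bit machine simulating a machine on pairs. -/
inductive SplitStep (P : PairTM) :
    SplitState P.State → Bool → SplitState P.State → Bool → Move → Prop
  | fst (q : P.State) (b : Bool) : SplitStep P (.fst q) b (.snd q b) b .right
  | snd {q p : P.State} {x b x' y' : Bool} {m : Move} (h : (p, (x', y'), m) ∈ P.δ q (x, b)) :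
      SplitStep P (.snd q x) b (.back p x' m) y' .left
  -- The guard makes the bit machine write-once on arbitrary tapes; in the intended runs it holds
  -- because `P` is write-once.
  | back {b x : Bool} (p : P.State) (m : Move) (h : b ≤ x) :
      SplitStep P (.back p x m) b (.go p m) x m
  | go (p : P.State) (b : Bool) (m : Move) : SplitStep P (.go p m) b (.fst p) b m

/-- The bit machine simulating a machine on pairs. -/
abbrev toNTM (P : PairTM) : NTM where
  State := SplitState P.State
  finite_state := have := P.finite_state; inferInstance
  start := .fst P.start
  accept := {s | ∃ q ∈ P.accept, s = .fst q}
  δ s b := {r | SplitStep P s b r.1 r.2.1 r.2.2}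

theorem WriteOnce.toNTM {P : PairTM} (hP : P.WriteOnce) : P.toNTM.WriteOnce := by
  intro s p m h
  replace h : SplitStep P s true p false m := h
  cases h with
  | snd hδ => exact absurd (show true ≤ false from (hP _ _ _ _ _ hδ).2) (by decide)
  | back p m h => exact absurd h (by decide)

theorem apply_apply_two_mul (m : Move) (h : ℕ) :
    m.apply (m.apply (2 * h)) = 2 * m.apply h := by
  cases m <;> simp only [Move.apply] <;> omega

/-- The configurations of the bit machine that stand for a configuration of the machine on pairs. -/
inductive Simulates {P : PairTM} : P.toNTM.Cfg → P.Cfg → Prop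
  | fst (q : P.State) (h : ℕ) (τ : ℕ → Bool × Bool) :
      Simulates ⟨.fst q, 2 * h, join τ⟩ ⟨q, h, τ⟩
  | snd (q : P.State) (h : ℕ) (τ : ℕ → Bool × Bool) :
      Simulates ⟨.snd q (τ h).1, 2 * h + 1, join τ⟩ ⟨q, h, τ⟩
  | back (p : P.State) (h : ℕ) (τ : ℕ → Bool × Bool) (x y : Bool) (m : Move) :
      Simulates ⟨.back p x m, 2 * h, Function.update (join τ) (2 * h + 1) y⟩
        ⟨p, m.apply h, Function.update τ h (x, y)⟩
  | go (p : P.State) (h : ℕ) (τ : ℕ → Bool × Bool) (m : Move) :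
      Simulates ⟨.go p m, m.apply (2 * h), join τ⟩ ⟨p, m.apply h, τ⟩

/-- The whole step on pairs is charged to the reading of the second bit, where the transition is
chosen; the other three bit steps leave the represented configuration unchanged. -/
theorem Simulates.step {P : PairTM} {c d : P.toNTM.Cfg} {C : P.Cfg} (hc : Simulates c C)
    (h : P.toNTM.Step c d) : ∃ D, Relation.ReflTransGen P.Step C D ∧ Simulates d D := by
  obtain ⟨b, m, hδ, hh, ht⟩ := h
  obtain ⟨s, e, t⟩ := d
  replace hδ : SplitStep P c.state (c.tape c.head) s b m := hδ
  dsimp only at hh ht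
  subst hh ht
  cases hc with
  | fst q h τ =>
    dsimp only at hδ ⊢
    rw [join_two_mul] at hδ
    cases hδ
    refine ⟨_, .refl, ?_⟩
    rw [← join_two_mul, Function.update_eq_self, join_two_mul]
    exact .snd q h τ
  | snd q h τ =>
    dsimp only at hδ ⊢
    rw [join_two_mul_add_one] at hδ
    cases hδ with
    | @snd _ p _ _ x' _ m' hδ =>
    exact ⟨⟨p, m'.apply h, Function.update τ h (x', b)⟩, .single ⟨(x', b), m', hδ, rfl, rfl⟩,
      .back p h τ x' b m'⟩
  | back p h τ x y m' =>
    cases hδ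
    refine ⟨_, .refl, ?_⟩
    dsimp only
    rw [join_update]
    exact .go p h _ m
  | go p h τ m' =>
    dsimp only at hδ ⊢
    generalize hb : join τ (m'.apply (2 * h)) = b' at hδ
    cases hδ
    subst hb
    refine ⟨_, .refl, ?_⟩
    rw [Function.update_eq_self, apply_apply_two_mul]
    exact .fst p _ τ

theorem exists_of_toNTM_accepts {P : PairTM} {w : List Bool} (h : P.toNTM.Accepts w) :
    ∃ C, Relation.ReflTransGen P.Step (P.init w) C ∧ C.state ∈ P.accept := by
  obtain ⟨d, hd, ha⟩ := NTM.accepts_iff_acceptsFrom.1 h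
  have h0 : Simulates (P.toNTM.init w) (P.init w) := by
    have := Simulates.fst P.start 0 (letterTape w)
    rw [join_letterTape] at this
    exact this
  have key : ∃ D, Relation.ReflTransGen P.Step (P.init w) D ∧ Simulates d D := by
    clear ha
    induction hd with
    | refl => exact ⟨_, .refl, h0⟩
    | tail _ hbc ih =>
      obtain ⟨D, hD, hs⟩ := ih
      obtain ⟨E, hE, hs'⟩ := hs.step hbc
      exact ⟨E, hD.trans hE, hs'⟩
  obtain ⟨D, hD, hs⟩ := key
  refine ⟨D, hD, ?_⟩
  obtain ⟨q, hq, hdq⟩ := ha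
  cases hs <;> simp_all

theorem StepWithin.toNTM {P : PairTM} (hP : P.WriteOnce) {S : ℕ} {c d : P.Cfg}
    (h : P.StepWithin S c d) :
    Relation.ReflTransGen (P.toNTM.StepWithin (2 * S))
      ⟨.fst c.state, 2 * c.head, join c.tape⟩ ⟨.fst d.state, 2 * d.head, join d.tape⟩ := by
  obtain ⟨⟨a, m, hδ, hh, ht⟩, hc, hd⟩ := h
  obtain ⟨p, h', τ'⟩ := d
  obtain ⟨q, h, τ⟩ := c
  dsimp only at *
  subst hh ht
  obtain ⟨x', y'⟩ := a
  have hle := hP _ _ _ _ _ hδ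
  have hm : m.apply (2 * h) < 2 * S := by
    revert hd; cases m <;> simp only [Move.apply] <;> omega
  refine .head (b := ⟨.snd q (τ h).1, 2 * h + 1, join τ⟩) ⟨⟨(τ h).1, .right, ?_, rfl, ?_⟩, ?_, ?_⟩ <|
    .head (b := ⟨.back p x' m, 2 * h, Function.update (join τ) (2 * h + 1) y'⟩)
      ⟨⟨y', .left, ?_, ?_, ?_⟩, ?_, ?_⟩ <|
    .head (b := ⟨.go p m, m.apply (2 * h), join (Function.update τ h (x', y'))⟩)
      ⟨⟨x', m, ?_, rfl, ?_⟩, ?_, ?_⟩ <|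
    .single ⟨⟨join (Function.update τ h (x', y')) (m.apply (2 * h)), m, ?_, ?_, ?_⟩, ?_, ?_⟩
  all_goals dsimp only
  any_goals omega
  · rw [join_two_mul]
    exact .fst q _
  · rw [← join_two_mul, Function.update_eq_self]
  · rw [join_two_mul_add_one]
    exact .snd hδ
  · simp [Move.apply]
  · refine .back p m ?_
    rw [Function.update_of_ne (by omega), join_two_mul]
    exact hle.1
  · rw [join_update]
  · exact .go p _ m
  · rw [apply_apply_two_mul]
  · rw [Function.update_eq_self]

theorem toNTM_acceptsInSpace {P : PairTM} (hP : P.WriteOnce) {w : List Bool} {S : ℕ} {C : P.Cfg}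
    (hS : 0 < S) (h : Relation.ReflTransGen (P.StepWithin S) (P.init w) C)
    (hC : C.state ∈ P.accept) : P.toNTM.AcceptsInSpace w (2 * S) := by
  refine NTM.acceptsInSpace_of_reflTransGen (d := ⟨.fst C.state, 2 * C.head, join C.tape⟩)
    (by omega) ?_ ⟨_, hC, rfl⟩
  have h0 : P.toNTM.init w =
      ⟨.fst (P.init w).state, 2 * (P.init w).head, join (P.init w).tape⟩ := by
    simp only [init, join_letterTape]; rfl
  rw [h0]
  clear hC h0
  induction h with
  | refl => exact .refl
  | tail _ hbc ih => exact ih.trans (hbc.toNTM hP)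

end PairTM

/-! ### Queue machines -/

/-- A nondeterministic machine whose storage is a queue of bits.  A rule removes a word at the front
of the queue and appends a word at its end.  On input `w`, the first letter of `w` is given to the
machine in its initial state, and the queue holds the rest of `w`. -/
structure QueueMachine where
  State : Type
  finite_state : Finite State
  start : Option Bool → State
  final : State
  rules : State → List Bool → List Bool → State → Prop
  bound : ℕ
  length_le : ∀ {q u v p}, rules q u v p → u.length ≤ bound ∧ v.length ≤ bound

namespace QueueMachine

/-- `Q.Accepts q x n`: from state `q` with queue `x`, the machine can reach its final state with an
empty queue while appending at most `n` bits. -/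
inductive Accepts (Q : QueueMachine) : Q.State → List Bool → ℕ → Prop
  | final (n : ℕ) : Accepts Q Q.final [] n
  | step {q p : Q.State} {u v x : List Bool} {m n : ℕ} (h : Q.rules q u v p)
      (hm : Accepts Q p (x ++ v) m) (hn : m + v.length ≤ n) : Accepts Q q (u ++ x) n

theorem Accepts.mono {Q : QueueMachine} {q : Q.State} {x : List Bool} {m n : ℕ}
    (h : Q.Accepts q x m) (hmn : m ≤ n) : Q.Accepts q x n := by
  cases h with
  | final => exact .final n
  | step h hm hn => exact .step h hm (hn.trans hmn)

/-- The words of length at most `n`. -/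
abbrev Word (n : ℕ) : Type := {l : List Bool // l.length ≤ n}

instance Word.instFinite (n : ℕ) : Finite (Word n) := (List.finite_length_le Bool n).to_subtype

/-- Control states of the machine on pairs: `work u v q` still has to remove `u` and to append `v`
before entering `q`; `seekL` and `seekR` look for the front of the queue. -/
inductive Control (Q : QueueMachine) where
  | init
  | work (u v : Word Q.bound) (q : Q.State)
  | seekL (u v : Word Q.bound) (q : Q.State)
  | seekR (u v : Word Q.bound) (q : Q.State)
  | acc

instance Control.instFinite (Q : QueueMachine) : Finite (Control Q) :=
  have := Q.finite_state
  Finite.of_injective (β := Option (Option (Fin 3 × Word Q.bound × Word Q.bound × Q.State)))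
    (fun s => match s with
      | .init => none
      | .acc => some none
      | .work u v q => some (some (0, u, v, q))
      | .seekL u v q => some (some (1, u, v, q))
      | .seekR u v q => some (some (2, u, v, q)))
    (by intro a b h; cases a <;> cases b <;> simp_all)

/-- Transitions of the write-once machine on pairs: removed letters are crossed out to `11`. -/
inductive Trans (Q : QueueMachine) :
    Control Q → Bool × Bool → Control Q → Bool × Bool → Move → Prop
  | init_nil {u v : Word Q.bound} (hu : u.1 = []) (hv : v.1 = []) :
      Trans Q .init (false, false) (.work u v (Q.start none)) (true, true) .stay
  | init_cons {u v : Word Q.bound} (b : Bool) (hu : u.1 = []) (hv : v.1 = []) :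
      Trans Q .init (!b, b) (.work u v (Q.start (some b))) (true, true) .stay
  | rule {u₀ v₀ u v : Word Q.bound} {q p : Q.State} (a : Bool × Bool) (hu : u₀.1 = [])
      (hv : v₀.1 = []) (h : Q.rules q u.1 v.1 p) :
      Trans Q (.work u₀ v₀ q) a (.work u v p) a .stay
  | seek (u v : Word Q.bound) (q : Q.State) (a : Bool × Bool) :
      Trans Q (.work u v q) a (.seekL u v q) a .stay
  -- Appending waits until the removal is complete; otherwise the machine could remove letters that
  -- the same rule has appended.
  | push {u v v' : Word Q.bound} {b : Bool} (q : Q.State) (hu : u.1 = []) (hv : v.1 = b :: v'.1) :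
      Trans Q (.work u v q) (false, false) (.work u v' q) (!b, b) .stay
  | skip (u v : Word Q.bound) (q : Q.State) {a : Bool × Bool} (ha : a ≠ (false, false)) :
      Trans Q (.work u v q) a (.work u v q) a .right
  | left (u v : Word Q.bound) (q : Q.State) (a : Bool × Bool) :
      Trans Q (.seekL u v q) a (.seekL u v q) a .left
  | turn (u v : Word Q.bound) (q : Q.State) :
      Trans Q (.seekL u v q) (true, true) (.seekR u v q) (true, true) .stay
  | right (u v : Word Q.bound) (q : Q.State) :
      Trans Q (.seekR u v q) (true, true) (.seekR u v q) (true, true) .right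
  | pop {u u' : Word Q.bound} (v : Word Q.bound) {b : Bool} (q : Q.State) (hu : u.1 = b :: u'.1) :
      Trans Q (.seekR u v q) (!b, b) (.work u' v q) (true, true) .stay
  | accept {u v : Word Q.bound} (hu : u.1 = []) (hv : v.1 = []) :
      Trans Q (.seekR u v Q.final) (false, false) .acc (false, false) .stay

/-- The write-once machine on pairs simulating a queue machine. -/
abbrev toPairTM (Q : QueueMachine) : PairTM where
  State := Control Q
  finite_state := inferInstance
  start := .init
  accept := {.acc}
  δ s a := {r | Trans Q s a r.1 r.2.1 r.2.2}

theorem toPairTM_writeOnce (Q : QueueMachine) : Q.toPairTM.WriteOnce := by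
  intro s a p a' m h
  replace h : Trans Q s a p a' m := h
  have hf : ∀ a : Bool × Bool, (false, false) ≤ a := fun a => ⟨Bool.false_le _, Bool.false_le _⟩
  have ht : ∀ a : Bool × Bool, a ≤ (true, true) := fun a => ⟨Bool.le_true _, Bool.le_true _⟩
  cases h <;> first | exact le_rfl | exact hf _ | exact ht _

open PairTM (letterTape)

/-- `i` crossed-out symbols, the queue `x`, and blanks. -/
def queueTape (i : ℕ) (x : List Bool) (j : ℕ) : Bool × Bool :=
  if j < i then (true, true) else letterTape x (j - i)

theorem queueTape_zero (x : List Bool) : queueTape 0 x = letterTape x := by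
  funext j; simp [queueTape]

theorem queueTape_of_lt {i j : ℕ} (x : List Bool) (h : j < i) : queueTape i x j = (true, true) := by
  simp [queueTape, h]

theorem queueTape_end (i : ℕ) (x : List Bool) : queueTape i x (i + x.length) = (false, false) := by
  simp [queueTape, letterTape]

theorem queueTape_ne {i j : ℕ} {x : List Bool} (h : j < i + x.length) :
    queueTape i x j ≠ (false, false) := by
  unfold queueTape
  split_ifs with hj
  · simp
  · rw [letterTape, List.getElem?_eq_getElem (by omega)]
    simp

theorem queueTape_self_cons (i : ℕ) (b : Bool) (x : List Bool) :
    queueTape i (b :: x) i = (!b, b) := by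
  simp [queueTape, letterTape]

theorem queueTape_self_nil (i : ℕ) : queueTape i [] i = (false, false) := by
  simp [queueTape, letterTape]

theorem update_queueTape_push (i : ℕ) (x : List Bool) (b : Bool) :
    Function.update (queueTape i x) (i + x.length) (!b, b) = queueTape i (x ++ [b]) := by
  funext j
  by_cases hj : j = i + x.length
  · subst hj
    simp [queueTape, letterTape]
  · rw [Function.update_of_ne hj]
    unfold queueTape
    split_ifs with h
    · rfl
    · unfold letterTape
      rcases lt_or_ge (j - i) x.length with h' | h'
      · rw [List.getElem?_append_left h']
      · rw [List.getElem?_eq_none h', List.getElem?_eq_none]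
        simp only [List.length_append, List.length_cons, List.length_nil]
        omega

theorem update_queueTape_pop (i : ℕ) (x : List Bool) (b : Bool) :
    Function.update (queueTape i (b :: x)) i (true, true) = queueTape (i + 1) x := by
  funext j
  rcases lt_trichotomy j i with h | rfl | h
  · rw [Function.update_of_ne h.ne, queueTape_of_lt _ h, queueTape_of_lt _ (by omega)]
  · rw [Function.update_self, queueTape_of_lt _ (by omega)]
  · rw [Function.update_of_ne h.ne', queueTape, queueTape, if_neg (by omega), if_neg (by omega)]
    obtain ⟨k, rfl⟩ := Nat.exists_eq_add_of_lt h
    simp [letterTape, show i + k + 1 - i = k + 1 by omega]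

theorem update_queueTape_nil (i : ℕ) :
    Function.update (queueTape i []) i (true, true) = queueTape (i + 1) [] := by
  funext j
  rcases lt_trichotomy j i with h | rfl | h
  · rw [Function.update_of_ne h.ne, queueTape_of_lt _ h, queueTape_of_lt _ (by omega)]
  · rw [Function.update_self, queueTape_of_lt _ (by omega)]
  · rw [Function.update_of_ne h.ne', queueTape, queueTape, if_neg (by omega), if_neg (by omega)]
    simp [letterTape]

/-! ### Soundness of the queue on a write-once tape -/

/-- From queue `x`, removing `u` and appending `v` leads to acceptance from `q`. -/
def Pending (Q : QueueMachine) (u v : List Bool) (q : Q.State) (x : List Bool) : Prop :=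
  ∃ x' n, x = u ++ x' ∧ Q.Accepts q (x' ++ v) n

/-- The configurations in which the machine on pairs has queue `x`. -/
inductive Represents {Q : QueueMachine} :
    Q.toPairTM.Cfg → Word Q.bound → Word Q.bound → Q.State → ℕ → List Bool → Prop
  | work {u v : Word Q.bound} {q : Q.State} {h i : ℕ} {x : List Bool} (hh : h ≤ i + x.length) :
      Represents ⟨.work u v q, h, queueTape i x⟩ u v q i x
  | seekL {u v : Word Q.bound} {q : Q.State} {h i : ℕ} {x : List Bool} (hh : h ≤ i + x.length) :
      Represents ⟨.seekL u v q, h, queueTape i x⟩ u v q i x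
  | seekR {u v : Word Q.bound} {q : Q.State} {h i : ℕ} {x : List Bool} (hh : h ≤ i) :
      Represents ⟨.seekR u v q, h, queueTape i x⟩ u v q i x

/-- The run is read backwards from acceptance. The head bounds in `Represents` confine the wandering
head: letters are appended only at the first blank and removed only at the front. -/
theorem Represents.pending {Q : QueueMachine} {C E : Q.toPairTM.Cfg}
    (hC : Relation.ReflTransGen Q.toPairTM.Step C E) (hE : E.state = .acc) :
    ∀ {u v q i x}, Represents C u v q i x → Q.Pending u.1 v.1 q x := by
  induction hC using Relation.ReflTransGen.head_induction_on with
  | refl => intro u v q i x h; cases h <;> cases hE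
  | @head C D hstep hDE ih =>
    intro u v q i x hrep
    obtain ⟨a, m, hδ, hh, ht⟩ := hstep
    obtain ⟨s, e, t⟩ := D
    replace hδ : Trans Q C.state (C.tape C.head) s a m := hδ
    dsimp only at hh ht
    subst hh ht
    cases hrep with
    | @work _ _ _ h _ _ hh =>
      dsimp only at hδ ih
      generalize hc : queueTape i x h = c at hδ
      cases hδ with
      | @rule _ _ u' v' _ _ _ hu hv hr =>
        subst hc
        rw [Function.update_eq_self] at ih
        obtain ⟨x', n, rfl, hn⟩ := ih (.work hh)
        refine ⟨u'.1 ++ x', n + v'.1.length, by rw [hu]; rfl, ?_⟩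
        rw [hv, List.append_nil]
        exact .step hr hn le_rfl
      | seek =>
        subst hc
        rw [Function.update_eq_self] at ih
        exact ih (.seekL hh)
      | @push _ _ v' b _ hu hv =>
        -- No cell before the end of the queue is blank, so the scanned blank is the first one.
        have : h = i + x.length := by
          by_contra hne
          exact queueTape_ne (by omega) hc
        subst this
        rw [update_queueTape_push] at ih
        obtain ⟨x', n, hx, hn⟩ := ih (.work (by simp [Move.apply]))
        rw [hu, List.nil_append] at hx
        subst hx
        refine ⟨x, n, by rw [hu]; rfl, ?_⟩
        rw [hv]
        simpa using hn
      | skip _ _ _ ha =>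
        have : h ≠ i + x.length := by
          rintro rfl
          exact ha (hc.symm.trans (queueTape_end i x))
        subst hc
        rw [Function.update_eq_self] at ih
        exact ih (.work (by simp only [Move.apply]; omega))
    | @seekL _ _ _ h _ _ hh =>
      dsimp only at hδ ih
      generalize hc : queueTape i x h = c at hδ
      cases hδ with
      | left =>
        subst hc
        rw [Function.update_eq_self] at ih
        exact ih (.seekL (by simp only [Move.apply]; omega))
      | turn =>
        rw [← hc, Function.update_eq_self] at ih
        -- The symbol `11` encodes no queue letter, so it is found only in the crossed-out prefix.
        rcases le_or_gt h i with hi | hi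
        · exact ih (.seekR hi)
        · exfalso
          unfold queueTape letterTape at hc
          rw [if_neg (by omega)] at hc
          cases hx : x[h - i]? <;> simp [hx] at hc
    | @seekR _ _ _ h _ _ hh =>
      dsimp only at hδ ih
      generalize hc : queueTape i x h = c at hδ
      have hi : c ≠ (true, true) → h = i := by
        intro hne
        by_contra hlt
        exact hne (hc.symm.trans (queueTape_of_lt x (by omega)))
      cases hδ with
      | right =>
        have hlt : h < i := by
          by_contra hge
          obtain rfl : h = i := by omega
          cases x with
          | nil => simp [queueTape_self_nil] at hc
          | cons b x => simp [queueTape_self_cons] at hc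
        rw [← hc, Function.update_eq_self] at ih
        exact ih (.seekR hlt)
      | @pop _ u' _ b _ hu =>
        obtain rfl := hi (by simp)
        cases x with
        | nil => rw [queueTape_self_nil] at hc; cases b <;> simp at hc
        | cons b' x =>
          rw [queueTape_self_cons] at hc
          obtain rfl : b' = b := (Prod.mk.inj hc).2
          rw [update_queueTape_pop] at ih
          obtain ⟨x', n, rfl, hn⟩ := ih (.work (by simp only [Move.apply]; omega))
          exact ⟨x', n, by rw [hu]; rfl, hn⟩
      | accept hu hv =>
        obtain rfl := hi (by simp)
        cases x with
        | nil => exact ⟨[], 0, by rw [hu]; rfl, by rw [hv]; exact .final 0⟩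
        | cons b x => rw [queueTape_self_cons] at hc; cases b <;> simp at hc

theorem accepts_of_toPairTM {Q : QueueMachine} {w : List Bool} {E : Q.toPairTM.Cfg}
    (h : Relation.ReflTransGen Q.toPairTM.Step (Q.toPairTM.init w) E)
    (hE : E.state ∈ Q.toPairTM.accept) : ∃ n, Q.Accepts (Q.start w.head?) w.tail n := by
  replace hE : E.state = .acc := hE
  rcases Relation.ReflTransGen.cases_head h with rfl | ⟨D, hstep, hDE⟩
  · cases hE
  obtain ⟨a, m, hδ, hh, ht⟩ := hstep
  obtain ⟨s, e, t⟩ := D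
  replace hδ : Trans Q .init (letterTape w 0) s a m := hδ
  dsimp only [PairTM.init] at hh ht
  subst hh ht
  rw [← queueTape_zero] at hδ hDE
  generalize hc : queueTape 0 w 0 = c at hδ
  cases hδ with
  | init_nil hu hv =>
    cases w with
    | nil =>
      rw [update_queueTape_nil] at hDE
      obtain ⟨x', n, hx, hn⟩ := Represents.pending hDE hE (.work (by simp [Move.apply]))
      rw [hu] at hx
      rw [hv, List.append_nil] at hn
      obtain rfl : [] = x' := hx
      exact ⟨n, hn⟩
    | cons b w => rw [queueTape_self_cons] at hc; cases b <;> simp at hc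
  | init_cons b hu hv =>
    cases w with
    | nil => rw [queueTape_self_nil] at hc; cases b <;> simp at hc
    | cons b' w =>
      rw [queueTape_self_cons] at hc
      obtain rfl : b' = b := (Prod.mk.inj hc).2
      rw [update_queueTape_pop] at hDE
      obtain ⟨x', n, hx, hn⟩ := Represents.pending hDE hE (.work (by simp [Move.apply]))
      rw [hu] at hx
      rw [hv, List.append_nil] at hn
      obtain rfl : w = x' := hx
      exact ⟨n, hn⟩

/-! ### Completeness of the queue on a write-once tape, with its space bound -/

section Completeness

variable {Q : QueueMachine} {S i : ℕ} {u v : Word Q.bound} {q : Q.State} {x : List Bool}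

open Relation PairTM

theorem stepWithin_of_trans {s p : Control Q} {h : ℕ} {a b : Bool × Bool} {m : Move}
    {t t' : ℕ → Bool × Bool} (ht : t h = a) (hδ : Trans Q s a p b m)
    (ht' : Function.update t h b = t') (hh : h < S) (hm : m.apply h < S) :
    Q.toPairTM.StepWithin S ⟨s, h, t⟩ ⟨p, m.apply h, t'⟩ := by
  subst ht ht'
  exact ⟨⟨b, m, hδ, rfl, rfl⟩, hh, hm⟩

theorem reach_end (hS : i + x.length < S) {h : ℕ} (hh : h ≤ i + x.length) :
    ReflTransGen (Q.toPairTM.StepWithin S) ⟨.work u v q, h, queueTape i x⟩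
      ⟨.work u v q, i + x.length, queueTape i x⟩ := by
  obtain ⟨k, hk⟩ := Nat.exists_eq_add_of_le hh
  induction k generalizing h with
  | zero => rw [hk]; exact .refl
  | succ k ih =>
    exact .head (stepWithin_of_trans (m := .right) rfl (.skip _ _ _ (queueTape_ne (by omega)))
      (Function.update_eq_self _ _) (by omega) (by simp only [Move.apply]; omega))
      (ih (by simp only [Move.apply]; omega) (by simp only [Move.apply]; omega))

theorem reach_push (hu : u.1 = []) {h : ℕ} (hh : h ≤ i + x.length)
    (hS : i + x.length + v.1.length < S) :
    ∃ v' : Word Q.bound, v'.1 = [] ∧ ∃ h' ≤ i + (x ++ v.1).length,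
      ReflTransGen (Q.toPairTM.StepWithin S) ⟨.work u v q, h, queueTape i x⟩
        ⟨.work u v' q, h', queueTape i (x ++ v.1)⟩ := by
  obtain ⟨v, hv⟩ := v
  dsimp only at hS ⊢
  induction v generalizing x h with
  | nil => exact ⟨_, rfl, h, by simpa using hh, by rw [List.append_nil]⟩
  | cons b v ih =>
    simp only [List.length_cons] at hv hS
    obtain ⟨v', hv', h', hh', hr⟩ := ih (x := x ++ [b]) (h := i + x.length) (by simp) (by omega)
      (by simp only [List.length_append, List.length_cons, List.length_nil]; omega)
    simp only [List.append_assoc, List.cons_append, List.nil_append] at hh' hr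
    refine ⟨v', hv', h', hh', (reach_end (by omega) hh).trans (.head ?_ hr)⟩
    exact stepWithin_of_trans (m := .stay) (queueTape_end i x) (.push q hu rfl)
      (update_queueTape_push i x b) (by omega) (by simp only [Move.apply]; omega)

/-- The head walks left to cell `0`, which is crossed out because `1 ≤ i`, and then right across the
crossed-out prefix. -/
theorem reach_front (hi : 1 ≤ i) {h : ℕ} (hh : h < S) (hS : i < S) :
    ReflTransGen (Q.toPairTM.StepWithin S) ⟨.work u v q, h, queueTape i x⟩
      ⟨.seekR u v q, i, queueTape i x⟩ := by
  have hR : ∀ k h, h + k = i → ReflTransGen (Q.toPairTM.StepWithin S)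
      ⟨.seekR u v q, h, queueTape i x⟩ ⟨.seekR u v q, i, queueTape i x⟩ := by
    intro k
    induction k with
    | zero => intro h hk; rw [← hk]; exact .refl
    | succ k ih =>
      intro h hk
      have ht := queueTape_of_lt x (show h < i by omega)
      exact .head (stepWithin_of_trans (m := .right) ht (.right _ _ _)
        (by rw [← ht]; exact Function.update_eq_self _ _) (by omega)
        (by simp only [Move.apply]; omega))
        (ih _ (by simp only [Move.apply]; omega))
  have hL : ∀ h, h < S → ReflTransGen (Q.toPairTM.StepWithin S)
      ⟨.seekL u v q, h, queueTape i x⟩ ⟨.seekR u v q, i, queueTape i x⟩ := by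
    intro h
    induction h with
    | zero =>
      intro hh
      have ht := queueTape_of_lt x (show 0 < i by omega)
      exact .head (stepWithin_of_trans (m := .stay) ht (.turn _ _ _)
        (by rw [← ht]; exact Function.update_eq_self _ _) hh hh) (hR i 0 (by omega))
    | succ h ih =>
      intro hh
      exact .head (stepWithin_of_trans (m := .left) rfl (.left _ _ _ _)
        (Function.update_eq_self _ _) hh (by simp only [Move.apply]; omega)) (ih (by omega))
  exact .head (stepWithin_of_trans (m := .stay) rfl (.seek _ _ _ _)
        (Function.update_eq_self _ _) hh hh) (hL h hh)

theorem reach_pop (hi : 1 ≤ i) {h : ℕ} (hh : h ≤ i + (u.1 ++ x).length)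
    (hS : i + (u.1 ++ x).length < S) :
    ∃ u' : Word Q.bound, u'.1 = [] ∧ ∃ h' ≤ i + u.1.length + x.length,
      ReflTransGen (Q.toPairTM.StepWithin S) ⟨.work u v q, h, queueTape i (u.1 ++ x)⟩
        ⟨.work u' v q, h', queueTape (i + u.1.length) x⟩ := by
  obtain ⟨u, hu⟩ := u
  dsimp only at hS hh ⊢
  induction u generalizing i h with
  | nil => exact ⟨_, rfl, h, by simpa using hh, .refl⟩
  | cons b u ih =>
    simp only [List.length_cons, List.length_append, List.cons_append] at hu hS hh ih ⊢
    obtain ⟨u', hu', h', hh', hr⟩ := ih (i := i + 1) (h := i) (by omega) (by omega) (by omega)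
      (by omega)
    rw [show i + 1 + u.length = i + (u.length + 1) by omega] at hh' hr
    refine ⟨u', hu', h', hh', (reach_front hi (by omega) (by omega)).trans (.head ?_ hr)⟩
    exact stepWithin_of_trans (m := .stay) (queueTape_self_cons i b _) (.pop _ _ rfl)
      (update_queueTape_pop i _ b) (by omega) (by simp only [Move.apply]; omega)

/-- Removing a letter preserves `i + x.length`, the position of the first blank; only appending
increases it. Hence the appended bits alone determine the additional space. -/
theorem Accepts.reach {n : ℕ} (hacc : Q.Accepts q x n) (hu : u.1 = []) (hv : v.1 = [])
    (hi : 1 ≤ i) {h : ℕ} (hh : h ≤ i + x.length) (hS : i + x.length + n < S) :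
    ∃ C : Q.toPairTM.Cfg, C.state = .acc ∧
      ReflTransGen (Q.toPairTM.StepWithin S) ⟨.work u v q, h, queueTape i x⟩ C := by
  induction hacc generalizing u v i h with
  | final n =>
    simp only [List.length_nil] at hh hS
    refine ⟨⟨.acc, i, queueTape i []⟩, rfl,
      (reach_front hi (by omega) (by omega)).trans (.single ?_)⟩
    have ht := queueTape_self_nil i
    exact stepWithin_of_trans (m := .stay) ht (.accept hu hv)
      (by rw [← ht]; exact Function.update_eq_self _ _) (by omega)
      (by simp only [Move.apply]; omega)
  | @step q p y z x m n hr hm hn ih =>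
    obtain ⟨hy, hz⟩ := Q.length_le hr
    obtain ⟨u', hu', h', hh', hpop⟩ := reach_pop (Q := Q) (S := S) (u := ⟨y, hy⟩) (v := ⟨z, hz⟩)
      (q := p) (x := x) hi hh (by dsimp only; omega)
    simp only [List.length_append] at hh hS
    dsimp only at hh' hpop
    obtain ⟨v', hv', h'', hh'', hpush⟩ := reach_push (Q := Q) (S := S) (v := ⟨z, hz⟩)
      (q := p) (x := x) hu' hh' (by dsimp only; omega)
    dsimp only at hh'' hpush
    obtain ⟨C, hC, hreach⟩ := ih hu' hv' (by omega) hh''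
      (by simp only [List.length_append]; omega)
    refine ⟨C, hC, .head ?_ ((hpop.trans hpush).trans hreach)⟩
    exact stepWithin_of_trans (m := .stay) rfl (.rule _ hu hv hr)
      (Function.update_eq_self _ _) (by omega) (by simp only [Move.apply]; omega)

theorem Accepts.toPairTM {w : List Bool} {n : ℕ}
    (hacc : Q.Accepts (Q.start w.head?) w.tail n) :
    ∃ C, ReflTransGen (Q.toPairTM.StepWithin (w.length + n + 2)) (Q.toPairTM.init w) C ∧
      C.state ∈ Q.toPairTM.accept := by
  let e : Word Q.bound := ⟨[], Nat.zero_le _⟩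
  -- Cell `0` is crossed out at once, even for the empty word, and the blank behind the queue is
  -- visited too; hence `+ 2`.
  obtain ⟨C, hC, hr⟩ := hacc.reach (S := w.length + n + 2) (u := e) (v := e) (i := 1) (h := 0)
    rfl rfl le_rfl (by omega) (by rw [List.length_tail]; omega)
  refine ⟨C, .head (b := ⟨.work e e (Q.start w.head?), 0, queueTape 1 w.tail⟩) ?_ hr, hC⟩
  cases w with
  | nil =>
    exact stepWithin_of_trans (m := .stay) (by rw [← queueTape_zero, queueTape_self_nil])
      (.init_nil rfl rfl) (by rw [← queueTape_zero, update_queueTape_nil]; rfl)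
      (by omega) (by simp only [Move.apply]; omega)
  | cons b w =>
    exact stepWithin_of_trans (m := .stay) (by rw [← queueTape_zero, queueTape_self_cons])
      (.init_cons b rfl rfl) (by rw [← queueTape_zero, update_queueTape_pop]; rfl)
      (by omega) (by simp only [Move.apply]; omega)

end Completeness

/-- The write-once machine simulating a queue machine. -/
def toNTM (Q : QueueMachine) : NTM := Q.toPairTM.toNTM

theorem toNTM_writeOnce (Q : QueueMachine) : Q.toNTM.WriteOnce := Q.toPairTM_writeOnce.toNTM

theorem exists_accepts_of_toNTM {Q : QueueMachine} {w : List Bool} (h : Q.toNTM.Accepts w) :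
    ∃ n, Q.Accepts (Q.start w.head?) w.tail n :=
  let ⟨_, hC, hacc⟩ := PairTM.exists_of_toNTM_accepts h
  accepts_of_toPairTM hC hacc

theorem Accepts.toNTM {Q : QueueMachine} {w : List Bool} {n : ℕ}
    (h : Q.Accepts (Q.start w.head?) w.tail n) :
    Q.toNTM.AcceptsInSpace w (2 * (w.length + n + 2)) :=
  let ⟨_, hC, hacc⟩ := h.toPairTM
  PairTM.toNTM_acceptsInSpace Q.toPairTM_writeOnce (by omega) hC hacc

end QueueMachine

/-! ### Simulating a Turing machine by a queue machine -/

namespace NTM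

/-- The letters of the cyclic word that stands for a configuration: tape cells, a letter preceding
the scanned cell, and a letter preceding cell `0`. -/
inductive Letter where
  | cell (b : Bool)
  | head
  | mark

/-! ### A block code, its separator, and cyclic words -/

namespace Letter

/-- The common length three makes parsing from the front unique; the leading `false` keeps the
aligned block `111` free for detecting errors. -/
def code : Letter → List Bool
  | cell b => [false, false, b]
  | head => [false, true, false]
  | mark => [false, true, true]

def codes (s : List Letter) : List Bool := s.flatMap code

def cells (l : List Bool) : List Letter := l.map cell

theorem codes_append (s t : List Letter) : codes (s ++ t) = codes s ++ codes t :=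
  List.flatMap_append

theorem codes_cons (a : Letter) (s : List Letter) : codes (a :: s) = code a ++ codes s := rfl

theorem length_codes (s : List Letter) : (codes s).length = 3 * s.length := by
  induction s with
  | nil => rfl
  | cons a s ih =>
    rw [codes_cons, List.length_append, ih, List.length_cons]
    cases a <;> simp only [code, List.length_cons, List.length_nil] <;> omega

theorem cells_append (l m : List Bool) : cells (l ++ m) = cells l ++ cells m := List.map_append

theorem exists_of_codes_eq_append {s u : List Letter} {x : List Bool} (h : codes u ++ x = codes s) :
    ∃ s', s = u ++ s' ∧ x = codes s' := by
  induction u generalizing s with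
  | nil => exact ⟨s, rfl, h⟩
  | cons a u ih =>
    cases s with
    | nil =>
      have := congrArg List.length h
      rw [List.length_append, length_codes, length_codes, List.length_cons, List.length_nil] at this
      omega
    | cons b s =>
      rw [codes_cons, codes_cons, List.append_assoc] at h
      have hl : (code a).length = (code b).length := by cases a <;> cases b <;> rfl
      obtain ⟨h1, h2⟩ := List.append_inj h hl
      obtain ⟨s', rfl, hx⟩ := ih h2
      refine ⟨s', ?_, hx⟩
      have : a = b := by
        cases a <;> cases b <;> simp_all [code]
      rw [this, List.cons_append]

theorem codes_getElem_three_mul (s : List Letter) (m : ℕ) : (codes s)[3 * m]? ≠ some true := by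
  induction s generalizing m with
  | nil => simp [codes]
  | cons a s ih =>
    rw [codes_cons]
    rcases m with _ | m
    · cases a <;> simp [code]
    · have : (code a).length = 3 := by cases a <;> rfl
      rw [List.getElem?_append_right (by omega), this, show 3 * (m + 1) - 3 = 3 * m by omega]
      exact ih m

/-- An aligned block `111`, which is not the code of a letter. -/
def Bad (x : List Bool) : Prop :=
  ∃ y z, x = y ++ true :: true :: true :: z ∧ 3 ∣ y.length

theorem Bad.append {x : List Bool} (h : Bad x) (v : List Bool) : Bad (x ++ v) := by
  obtain ⟨y, z, rfl, hy⟩ := h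
  exact ⟨y, z ++ v, by simp, hy⟩

theorem not_bad_nil : ¬ Bad [] := by
  rintro ⟨y, z, h, -⟩
  simp at h

theorem Bad.of_codes_append {s : List Letter} {x : List Bool} (h : Bad (codes s ++ x)) : Bad x := by
  induction s with
  | nil => exact h
  | cons a s ih =>
    apply ih
    obtain ⟨y, z, h, hy⟩ := h
    rw [codes_cons, List.append_assoc] at h
    generalize codes s ++ x = x at h ⊢
    rcases y with _ | ⟨y1, _ | ⟨y2, _ | ⟨y3, y⟩⟩⟩
    · cases a <;> simp [code] at h
    · simp at hy
    · simp at hy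
    · refine ⟨y, z, ?_, ?_⟩
      · cases a <;> simp_all [code]
      · simp only [List.length_cons] at hy; omega

/-- The word separating the input from its recoded part.  It has no proper border. -/
def fence : List Bool := [false, true, true, true, true, true, true]

/-- What remains of the queue once a letter of the fence was taken for an input letter. -/
def Dead (x : List Bool) : Prop :=
  ∃ s y, y ++ x = List.replicate 6 true ++ codes s

theorem Dead.append {x : List Bool} (h : Dead x) (v : List Letter) : Dead (x ++ codes v) := by
  obtain ⟨s, y, h⟩ := h
  exact ⟨s ++ v, y, by rw [codes_append, ← List.append_assoc, h, List.append_assoc]⟩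

theorem Dead.of_cons {a : Bool} {x : List Bool} (h : Dead (a :: x)) : Dead x := by
  obtain ⟨s, y, h⟩ := h
  exact ⟨s, y ++ [a], by simpa using h⟩

theorem not_dead_fence_append (x : List Bool) : ¬ Dead (fence ++ x) := by
  rintro ⟨s, y, h⟩
  have key : ∀ t, 1 ≤ t → t < 7 → (y.length + t) % 3 = 0 → 6 ≤ y.length + t → False := by
    intro t h1 h7 h3 h6
    have h' := congrArg (·[y.length + t]?) h
    rw [List.getElem?_append_right (by omega), Nat.add_sub_cancel_left,
      List.getElem?_append_left (by simpa [fence] using h7),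
      List.getElem?_append_right (by simpa using h6), List.length_replicate,
      show y.length + t - 6 = 3 * ((y.length + t - 6) / 3) by omega] at h'
    refine codes_getElem_three_mul s _ (h'.symm.trans ?_)
    interval_cases t <;> rfl
  -- One of the last three ones of the fence sits at a multiple of three that is at least six, so
  -- past the leading ones, where a code word would begin with `false`.
  rcases (by omega : (y.length + 4) % 3 = 0 ∨ (y.length + 5) % 3 = 0 ∨ (y.length + 6) % 3 = 0)
    with h3 | h3 | h3
  · exact key 4 (by omega) (by omega) h3 (by omega)
  · exact key 5 (by omega) (by omega) h3 (by omega)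
  · exact key 6 (by omega) (by omega) h3 (by omega)

theorem bad_of_fence_append_eq {v x y : List Bool} (h : fence ++ x = v ++ (fence ++ y)) :
    (v = [] ∧ x = y) ∨ Bad x := by
  rcases v with _ | ⟨a1, _ | ⟨a2, _ | ⟨a3, _ | ⟨a4, _ | ⟨a5, _ | ⟨a6, _ | ⟨a7, v⟩⟩⟩⟩⟩⟩⟩
  · exact .inl ⟨rfl, by simpa using h⟩
  -- For `v` of length one to six the second fence would place its `false` on a one of the first.
  any_goals simp [fence] at h
  obtain ⟨-, -, -, -, -, -, -, rfl⟩ := h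
  refine .inr ?_
  -- Six consecutive ones contain an aligned `111` in every residue class.
  have h3 : v.length % 3 = 0 ∨ v.length % 3 = 1 ∨ v.length % 3 = 2 := by omega
  rcases h3 with h3 | h3 | h3
  · refine ⟨v ++ [false, true, true], true :: y, by simp, ?_⟩
    simp only [List.length_append, List.length_cons, List.length_nil]; omega
  · refine ⟨v ++ [false, true], true :: true :: y, by simp, ?_⟩
    simp only [List.length_append, List.length_cons, List.length_nil]; omega
  · refine ⟨v ++ [false], true :: true :: true :: y, by simp, ?_⟩
    simp only [List.length_append, List.length_cons, List.length_nil]; omega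

/-- The cyclic word of a configuration, with cells `A` to the left of the head and `R` from the head
on. -/
def word (A R : List Bool) : List Letter := head :: (cells R ++ mark :: cells A)

theorem head_notMem_tail (A R : List Bool) : head ∉ cells R ++ mark :: cells A := by
  simp [cells]

/-- A letter occurring only once pins down the rotation. With `head` as that letter, a cyclic word
determines its cells. -/
theorem eq_of_cons_isRotated_cons {α : Type*} {a : α} {l l' : List α} (h : (a :: l) ~r (a :: l'))
    (ha : a ∉ l') : l = l' := by
  obtain ⟨n, hn⟩ := h
  rw [List.rotate_eq_drop_append_take_mod] at hn
  have hx := List.take_append_drop (n % (a :: l).length) (a :: l)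
  generalize List.take (n % (a :: l).length) (a :: l) = x at hn hx
  generalize List.drop (n % (a :: l).length) (a :: l) = y at hn hx
  cases y with
  | nil =>
    rw [List.append_nil] at hx
    rw [List.nil_append, hx] at hn
    exact (List.cons.inj hn).2
  | cons b y =>
    cases x with
    | nil =>
      rw [List.nil_append] at hx
      rw [List.append_nil, hx] at hn
      exact (List.cons.inj hn).2
    | cons c x =>
      obtain ⟨rfl, rfl⟩ := List.cons.inj hn
      obtain ⟨rfl, -⟩ := List.cons.inj hx
      exact absurd (by simp) ha

end Letter

open Letter

/-! ### Machine steps as local rewriting of the cyclic word -/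

/-- The tape holds `A ++ R`, and the head is on the first cell of `R`. -/
structure Cfg.HasTape {M : NTM} (c : M.Cfg) (A R : List Bool) : Prop where
  head_eq : c.head = A.length
  tape_eq : c.tape = fun i => (A ++ R).getD i false

theorem Cfg.HasTape.read {M : NTM} {c : M.Cfg} {A R : List Bool} {a : Bool}
    (h : c.HasTape A (a :: R)) : c.tape c.head = a := by
  rw [h.tape_eq, h.head_eq]
  simp

theorem Cfg.HasTape.update {M : NTM} {c : M.Cfg} {A R : List Bool} {a : Bool}
    (h : c.HasTape A (a :: R)) (b : Bool) :
    Function.update c.tape c.head b = fun i => (A ++ b :: R).getD i false := by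
  rw [h.tape_eq, h.head_eq]
  funext i
  rcases lt_trichotomy i A.length with hi | rfl | hi
  · rw [Function.update_of_ne hi.ne]
    simp only [List.getD_eq_getElem?_getD]
    rw [List.getElem?_append_left hi, List.getElem?_append_left hi]
  · simp
  · rw [Function.update_of_ne hi.ne']
    simp only [List.getD_eq_getElem?_getD]
    rw [List.getElem?_append_right hi.le, List.getElem?_append_right hi.le]
    obtain ⟨k, hk⟩ := Nat.exists_eq_add_of_lt hi
    rw [show i - A.length = k + 1 by omega, List.getElem?_cons_succ, List.getElem?_cons_succ]

/-- Local changes of the cyclic word in one step. -/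
inductive Rewrite (M : NTM) : M.State → List Letter → List Letter → M.State → Prop
  | stay {q p : M.State} {a b : Bool} (h : (p, b, .stay) ∈ M.δ q a) :
      Rewrite M q [.head, .cell a] [.head, .cell b] p
  | right {q p : M.State} {a b : Bool} (h : (p, b, .right) ∈ M.δ q a) :
      Rewrite M q [.head, .cell a] [.cell b, .head] p
  | left {q p : M.State} {a b : Bool} (c : Bool) (h : (p, b, .left) ∈ M.δ q a) :
      Rewrite M q [.cell c, .head, .cell a] [.head, .cell c, .cell b] p
  | leftEnd {q p : M.State} {a b : Bool} (h : (p, b, .left) ∈ M.δ q a) :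
      Rewrite M q [.mark, .head, .cell a] [.mark, .head, .cell b] p

theorem Rewrite.exists_step {M : NTM} {c : M.Cfg} {p : M.State} {u v s : List Letter}
    {A R : List Bool} (h : M.Rewrite c.state u v p) (hc : c.HasTape A R)
    (hs : (u ++ s) ~r word A R) :
    ∃ d A' R', M.Step c d ∧ d.state = p ∧ d.HasTape A' R' ∧ (s ++ v) ~r word A' R' := by
  have hsplit : ∀ {a : Bool} {l : List Letter}, (.head :: .cell a :: l) ~r word A R →
      ∃ R', R = a :: R' ∧ l = cells R' ++ .mark :: cells A := by
    intro a l hl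
    have := eq_of_cons_isRotated_cons hl (head_notMem_tail A R)
    cases R with
    | nil => simp [cells] at this
    | cons a' R =>
      simp only [cells, List.map_cons, List.cons_append, List.cons.injEq, Letter.cell.injEq] at this
      obtain ⟨rfl, rfl⟩ := this
      exact ⟨R, rfl, rfl⟩
  cases h with
  | @stay _ a b h =>
    obtain ⟨R, rfl, rfl⟩ := hsplit hs
    rw [← hc.read] at h
    exact ⟨⟨p, c.head, Function.update c.tape c.head b⟩, A, b :: R, ⟨b, .stay, h, rfl, rfl⟩, rfl, ⟨hc.head_eq, hc.update b⟩,
      List.isRotated_append⟩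
  | @right _ a b h =>
    obtain ⟨R, rfl, rfl⟩ := hsplit hs
    rw [← hc.read] at h
    refine ⟨⟨p, c.head + 1, Function.update c.tape c.head b⟩, A ++ [b], R, ⟨b, .right, h, rfl, rfl⟩, rfl,
      ⟨by simp [hc.head_eq], by simpa using hc.update b⟩, ?_⟩
    have := List.isRotated_append (l := cells R ++ .mark :: cells A ++ [.cell b]) (l' := [.head])
    simpa [word, cells] using this
  | @left _ a b x h =>
    -- Rotating the predecessor of `head` to the end makes it the last letter of `word A R`: the
    -- last cell of `A`, or `mark` if `A` is empty. This separates `left` from `leftEnd`.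
    have hrot : (Letter.head :: .cell a :: s ++ [.cell x]) ~r word A R :=
      List.isRotated_append.trans (by simpa using hs)
    obtain ⟨R, rfl, hl⟩ := hsplit hrot
    rw [← hc.read] at h
    rcases List.eq_nil_or_concat' A with rfl | ⟨A, x', rfl⟩
    · simpa [cells] using (List.append_inj' hl rfl).2
    · rw [cells_append, ← List.cons_append, ← List.append_assoc] at hl
      obtain ⟨rfl, hx⟩ := List.append_inj' hl rfl
      obtain rfl : x = x' := by simpa [cells] using hx
      refine ⟨⟨p, c.head - 1, Function.update c.tape c.head b⟩, A, x :: b :: R, ⟨b, .left, h, rfl, rfl⟩, rfl,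
        ⟨by simp [hc.head_eq], by simpa using hc.update b⟩, List.isRotated_append⟩
  | @leftEnd _ a b h =>
    have hrot : (Letter.head :: .cell a :: s ++ [.mark]) ~r word A R :=
      List.isRotated_append.trans (by simpa using hs)
    obtain ⟨R, rfl, hl⟩ := hsplit hrot
    rw [← hc.read] at h
    rcases List.eq_nil_or_concat' A with rfl | ⟨A, x', rfl⟩
    · obtain ⟨rfl, -⟩ := List.append_inj' hl rfl
      refine ⟨⟨p, c.head - 1, Function.update c.tape c.head b⟩, [], b :: R, ⟨b, .left, h, rfl, rfl⟩, rfl,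
        ⟨by simp [hc.head_eq], by simpa using hc.update b⟩, ?_⟩
      have := List.isRotated_append (l := cells R ++ [.mark]) (l' := [.head, .cell b])
      simpa [word, cells] using this
    · rw [cells_append, ← List.cons_append, ← List.append_assoc] at hl
      simpa [cells] using (List.append_inj' hl rfl).2

theorem Step.exists_rewrite {M : NTM} {c d : M.Cfg} {A R : List Bool} (h : M.Step c d)
    (hc : c.HasTape A R) (hR : R ≠ []) :
    ∃ u v s A' R', M.Rewrite c.state u v d.state ∧ word A R ~r (u ++ s) ∧
      d.HasTape A' R' ∧ (s ++ v) ~r word A' R' ∧ A'.length + R'.length = A.length + R.length ∧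
      A'.length ≤ A.length + 1 ∧ v.length ≤ 3 := by
  obtain ⟨b, m, hδ, hh, ht⟩ := h
  obtain ⟨a, R, rfl⟩ := List.exists_cons_of_ne_nil hR
  rw [hc.read] at hδ
  rw [hc.update b] at ht
  rw [hc.head_eq] at hh
  cases m with
  | stay =>
    exact ⟨_, _, cells R ++ .mark :: cells A, A, b :: R, .stay hδ, .refl _, ⟨hh, ht⟩,
      List.isRotated_append, rfl, by omega, by simp⟩
  | right =>
    refine ⟨_, _, cells R ++ .mark :: cells A, A ++ [b], R, .right hδ, .refl _,
      ⟨by simpa [Move.apply] using hh, by simpa using ht⟩, ?_, ?_, by simp, by simp⟩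
    · have := List.isRotated_append (l := cells R ++ .mark :: cells A ++ [.cell b]) (l' := [.head])
      simpa [word, cells] using this
    · simp only [List.length_append, List.length_cons, List.length_nil]; omega
  | left =>
    rcases List.eq_nil_or_concat' A with rfl | ⟨A, x, rfl⟩
    · refine ⟨_, _, cells R, [], b :: R, .leftEnd hδ, ?_, ⟨hh, by simpa using ht⟩, ?_, rfl,
        by omega, by simp⟩
      · have := List.isRotated_append (l := .head :: .cell a :: cells R) (l' := [.mark])
        simpa [word, cells] using this
      · have := List.isRotated_append (l := cells R ++ [.mark]) (l' := [.head, .cell b])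
        simpa [word, cells] using this
    · refine ⟨_, _, cells R ++ .mark :: cells A, A, x :: b :: R, .left x hδ, ?_,
        ⟨by simpa [Move.apply] using hh, by simpa using ht⟩, List.isRotated_append, ?_, ?_, by simp⟩
      · have := List.isRotated_append (l := .head :: .cell a :: (cells R ++ .mark :: cells A))
          (l' := [.cell x])
        simpa [word, cells] using this
      · simp only [List.length_append, List.length_cons, List.length_nil]; omega
      · simp only [List.length_append, List.length_cons, List.length_nil]; omega

/-! ### The simulating queue machine and its soundness -/

/-- Control states of the queue machine: recode the input, append blanks, simulate, and empty the
queue. -/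
inductive Phase (Q : Type) where
  | start (o : Option Bool)
  | copy
  | pad
  | main (q : Q)
  | drain

instance Phase.instFinite (Q : Type) [Finite Q] : Finite (Phase Q) :=
  Finite.of_injective (β := Option Bool ⊕ Fin 3 ⊕ Q)
    (fun s => match s with
      | .start o => .inl o
      | .copy => .inr (.inl 0)
      | .pad => .inr (.inl 1)
      | .drain => .inr (.inl 2)
      | .main q => .inr (.inr q))
    (by intro a b h; cases a <;> cases b <;> simp_all)

/-- The cyclic word for the initial configuration on a tape with the cells of the word `w`, rotated
so that cell `0` comes first. -/
def initWord (l : List Bool) : List Letter := .mark :: .head :: cells l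

/-- The end of the input and the number of blanks are guessed. Any number of blanks is sound; a
wrong end of the input is exposed because `drain` removes only codes of letters and the queue has to
become empty. -/
inductive Rule (M : NTM) : Phase M.State → List Bool → List Bool → Phase M.State → Prop
  | start (o : Option Bool) :
      Rule M (.start o) [] (fence ++ codes (initWord (encode o.toList))) .copy
  | copy (a : Bool) : Rule M .copy [a] (codes (cells (encode [a]))) .copy
  | copyEnd : Rule M .copy fence [] .pad
  | pad : Rule M .pad [] (codes [.cell false]) .pad
  | padEnd : Rule M .pad [] [] (.main M.start)
  | rotate (q : M.State) (a : Letter) : Rule M (.main q) (codes [a]) (codes [a]) (.main q)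
  | rewrite {q p : M.State} {u v : List Letter} (h : M.Rewrite q u v p) :
      Rule M (.main q) (codes u) (codes v) (.main p)
  | accept {q : M.State} (h : q ∈ M.accept) : Rule M (.main q) [] [] .drain
  | drain (a : Letter) : Rule M .drain (codes [a]) [] .drain

/-- The queue machine simulating a Turing machine. -/
abbrev toQueueMachine (M : NTM) : QueueMachine where
  State := Phase M.State
  finite_state := have := M.finite_state; inferInstance
  start := .start
  final := .drain
  rules := Rule M
  -- The longest word is appended by `start`: seven bits of fence and at most four letters of three
  -- bits.
  bound := 19
  length_le := by
    intro q u v p h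
    cases h with
    | start o =>
      rw [List.length_append, length_codes]
      cases o <;> simp [fence, initWord, encode, cells]
    | copy a => rw [length_codes]; simp [encode, cells]
    | rewrite h => rw [length_codes, length_codes]; cases h <;> simp
    | _ => simp [fence, length_codes]

/-- The invariant for the phases of the simulation on input `w`, in terms of acceptance. -/
def Sound (M : NTM) (w : List Bool) : Phase M.State → List Bool → Prop
  | .start o, x => w = o.toList ++ x → M.AcceptsFrom (M.init w)
  | .copy, x => ¬ Dead x ∧ ∀ u v, w = u ++ v →
      x = v ++ (fence ++ codes (initWord (encode u))) → M.AcceptsFrom (M.init w)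
  | .pad, x => ¬ Bad x ∧ ∀ k, x = codes (initWord (encode w ++ List.replicate k false)) →
      M.AcceptsFrom (M.init w)
  | .main q, x => ¬ Bad x ∧ ∀ (c : M.Cfg) A R s, c.state = q → c.HasTape A R → s ~r word A R →
      x = codes s → M.AcceptsFrom c
  | .drain, x => ¬ Bad x

theorem encode_append (u v : List Bool) : encode (u ++ v) = encode u ++ encode v :=
  List.flatMap_append

theorem init_hasTape (M : NTM) (w : List Bool) (k : ℕ) :
    (M.init w).HasTape [] (encode w ++ List.replicate k false) := by
  refine ⟨rfl, ?_⟩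
  funext i
  simp only [init, List.nil_append, List.getD_eq_getElem?_getD]
  rcases lt_or_ge i (encode w).length with hi | hi
  · rw [List.getElem?_append_left hi]
  · rw [List.getElem?_append_right hi, List.getElem?_eq_none hi, List.getElem?_replicate]
    split_ifs <;> rfl

theorem initWord_append (l m : List Bool) : initWord (l ++ m) = initWord l ++ cells m := by
  simp [initWord, cells]

theorem initWord_isRotated (l : List Bool) : initWord l ~r word [] l := by
  have := List.isRotated_append (l := [.mark]) (l' := .head :: cells l)
  simpa [initWord, word, cells] using this

/-- Induction runs backwards from the empty queue, so the invariant says what acceptance implies: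
the queue is not spoiled by a wrong guess, and if it has the intended form then `M` accepts. -/
theorem sound_of_accepts {M : NTM} {w : List Bool} {s : M.toQueueMachine.State}
    {x : List Bool} {n : ℕ}
    (h : M.toQueueMachine.Accepts s x n) : M.Sound w s x := by
  induction h with
  | final n => exact not_bad_nil
  | @step q p u v x m n hr _ _ ih =>
    replace hr : Rule M q u v p := hr
    cases hr with
    | start o =>
      rintro hw
      exact ih.2 o.toList x hw rfl
    | copy a =>
      refine ⟨fun hd => ih.1 (hd.of_cons.append _), fun u v hw hx => ?_⟩
      cases v with
      | nil =>
        -- The input is exhausted, so the removed bit was the first bit of the fence and the rest is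
        -- dead.
        obtain ⟨-, rfl⟩ := List.cons.inj hx
        exact absurd (Dead.append ⟨_, [], rfl⟩ _) ih.1
      | cons b v =>
        obtain ⟨rfl, rfl⟩ := List.cons.inj hx
        refine ih.2 (u ++ [a]) v (by simpa using hw) ?_
        rw [encode_append, initWord_append, codes_append]
        simp
    | copyEnd =>
      rw [List.append_nil] at ih
      refine ⟨not_dead_fence_append x, fun u v hw hx => ?_⟩
      -- Either the removed fence is the true one, or it was read from the input and the true one
      -- spoils the rest.
      rcases bad_of_fence_append_eq hx with ⟨rfl, rfl⟩ | hb
      · rw [List.append_nil] at hw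
        exact ih.2 0 (by rw [hw, List.replicate_zero, List.append_nil])
      · exact absurd hb ih.1
    | pad =>
      refine ⟨fun hb => ih.1 (hb.append _), fun k hx => ih.2 (k + 1) ?_⟩
      rw [List.nil_append] at hx
      rw [hx, List.replicate_succ', ← List.append_assoc, initWord_append _ [false], codes_append]
      rfl
    | padEnd =>
      rw [List.append_nil] at ih
      exact ⟨ih.1, fun k hx => ih.2 _ _ _ _ rfl (init_hasTape M w k) (initWord_isRotated _) hx⟩
    | rotate q a =>
      refine ⟨fun hb => ih.1 (hb.of_codes_append.append _), fun c A R s hq hc hs hx => ?_⟩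
      obtain ⟨s, rfl, rfl⟩ := exists_of_codes_eq_append hx
      exact ih.2 c A R (s ++ [a]) hq hc (List.isRotated_append.trans hs) (codes_append _ _).symm
    | rewrite h =>
      refine ⟨fun hb => ih.1 (hb.of_codes_append.append _), fun c A R s hq hc hs hx => ?_⟩
      obtain ⟨s, rfl, rfl⟩ := exists_of_codes_eq_append hx
      subst hq
      obtain ⟨d, A', R', hstep, hd, hd', hs'⟩ := h.exists_step hc hs
      exact (ih.2 d A' R' _ hd hd' hs' (codes_append _ _).symm).head hstep
    | accept h =>
      rw [List.append_nil] at ih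
      exact ⟨ih, fun c A R s hq hc hs hx => ⟨c, .refl, hq ▸ h⟩⟩
    | drain a =>
      rw [List.append_nil] at ih
      exact fun hb => ih hb.of_codes_append

theorem accepts_of_toQueueMachine {M : NTM} {w : List Bool} {n : ℕ}
    (h : M.toQueueMachine.Accepts (.start w.head?) w.tail n) : M.Accepts w := by
  refine accepts_iff_acceptsFrom.2 (sound_of_accepts (w := w) h ?_)
  cases w <;> rfl

/-! ### Completeness of the simulation, counting appended bits -/

section Completeness

variable {M : NTM} {q : M.State} {n : ℕ}

theorem accepts_drain (s : List Letter) : M.toQueueMachine.Accepts .drain (codes s) n := by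
  induction s with
  | nil => exact .final n
  | cons a s ih =>
    have : codes (a :: s) = codes [a] ++ codes s := codes_append [a] s
    rw [this]
    exact .step (m := n) (.drain a) (by rwa [List.append_nil]) le_rfl

theorem accepts_append_swap {x y : List Letter}
    (h : M.toQueueMachine.Accepts (.main q) (codes (y ++ x)) n) :
    M.toQueueMachine.Accepts (.main q) (codes (x ++ y)) (n + 3 * x.length) := by
  induction x generalizing y with
  | nil => simpa using h
  | cons a x ih =>
    have e : codes (a :: x ++ y) = codes [a] ++ codes (x ++ y) := codes_append [a] (x ++ y)
    rw [e]
    refine .step (m := n + 3 * x.length) (.rotate q a) ?_ ?_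
    · rw [← codes_append, List.append_assoc]
      exact ih (by simpa using h)
    · rw [length_codes]
      simp only [List.length_cons, List.length_nil]; omega

theorem accepts_of_isRotated {s t : List Letter} {N : ℕ} (hst : s ~r t) (hs : s.length ≤ N)
    (h : M.toQueueMachine.Accepts (.main q) (codes t) n) :
    M.toQueueMachine.Accepts (.main q) (codes s) (n + 3 * N) := by
  obtain ⟨k, rfl⟩ := hst
  rw [List.rotate_eq_drop_append_take_mod] at h
  have := accepts_append_swap h
  rw [List.take_append_drop] at this
  refine this.mono ?_
  have := List.length_take_le' (k % s.length) s
  omega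

theorem length_word (A R : List Bool) : (word A R).length = A.length + R.length + 2 := by
  simp only [word, cells, List.length_cons, List.length_append, List.length_map]
  omega

/-- Each step costs two rotations of at most `3 * N` bits, before and after a rewriting that appends
at most `9`. The right part `R` loses at most one cell per step, so `n < R.length` keeps a cell
under the head. -/
theorem accepts_main {f : ℕ → M.Cfg} {A R : List Bool} {N : ℕ}
    (hf : ∀ i < n, M.Step (f i) (f (i + 1))) (hacc : (f n).state ∈ M.accept)
    (h0 : (f 0).HasTape A R) (hR : n < R.length) (hN : A.length + R.length + 2 = N) :
    M.toQueueMachine.Accepts (.main (f 0).state) (codes (word A R)) (n * (6 * N + 9)) := by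
  induction n generalizing f A R with
  | zero =>
    exact .step (u := []) (x := codes (word A R)) (m := 0) (.accept hacc)
      (by rw [List.append_nil]; exact accepts_drain _) (Nat.zero_le _)
  | succ n ih =>
    obtain ⟨u, v, s, A', R', hr, h1, h2, h3, h4, h5, h6⟩ :=
      (hf 0 (Nat.succ_pos n)).exists_rewrite h0 (List.ne_nil_of_length_pos (by omega))
    have := ih (f := fun i => f (i + 1)) (fun i hi => hf (i + 1) (by omega)) hacc h2 (by omega)
      (by omega)
    have := accepts_of_isRotated h3 (N := N)
      (by rw [h3.perm.length_eq, length_word]; omega) this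
    rw [codes_append] at this
    have := QueueMachine.Accepts.step (n := n * (6 * N + 9) + 3 * N + 9)
      (Q := M.toQueueMachine) (.rewrite hr) this (by rw [length_codes]; omega)
    rw [← codes_append] at this
    refine (accepts_of_isRotated h1 (N := N) (by rw [length_word]; omega) this).mono ?_
    rw [Nat.succ_mul n]; omega

theorem accepts_pad {k : ℕ} {l : List Bool}
    (h : M.toQueueMachine.Accepts (.main M.start)
      (codes (initWord (l ++ List.replicate k false))) n) :
    M.toQueueMachine.Accepts .pad (codes (initWord l)) (n + 3 * k) := by
  induction k generalizing l with
  | zero =>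
    rw [List.replicate_zero, List.append_nil] at h
    exact .step (u := []) .padEnd (by rwa [List.append_nil]) le_rfl
  | succ k ih =>
    refine .step (u := []) (x := codes (initWord l)) (m := n + 3 * k) .pad ?_
      (by rw [length_codes, List.length_singleton]; omega)
    rw [← codes_append]
    have := ih (l := l ++ [false]) (by simpa [List.replicate_succ] using h)
    rwa [initWord_append] at this

theorem accepts_copy {u v : List Bool}
    (h : M.toQueueMachine.Accepts .pad (codes (initWord (encode (u ++ v)))) n) :
    M.toQueueMachine.Accepts .copy (v ++ (fence ++ codes (initWord (encode u))))
      (n + 6 * v.length) := by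
  induction v generalizing u with
  | nil =>
    rw [List.append_nil] at h
    exact .step (u := fence) .copyEnd (by rwa [List.append_nil]) le_rfl
  | cons a v ih =>
    refine .step (u := [a]) (x := v ++ _) (m := n + 6 * v.length) (.copy a) ?_ ?_
    · have := ih (u := u ++ [a]) (by simpa using h)
      rw [encode_append, initWord_append, codes_append] at this
      simpa only [List.append_assoc] using this
    · rw [length_codes]
      simp only [cells, encode, List.length_map, List.flatMap_cons, List.flatMap_nil,
        List.length_cons, List.length_append, List.length_nil]
      omega

theorem length_encode (w : List Bool) : (encode w).length = 2 * w.length := by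
  induction w with
  | nil => rfl
  | cons a w ih =>
    have : encode (a :: w) = (!a) :: a :: encode w := rfl
    rw [this, List.length_cons, List.length_cons, List.length_cons, ih]
    omega

theorem AcceptsInTime.toQueueMachine {w : List Bool} {T : ℕ} (h : M.AcceptsInTime w T) :
    M.toQueueMachine.Accepts (.start w.head?) w.tail
      (T * (6 * (2 * w.length + T + 3) + 9) + 3 * (2 * w.length + T + 3) + 3 * (T + 1) +
        6 * w.length + 19) := by
  obtain ⟨n, f, ⟨h0, hf, hacc⟩, hn⟩ := h
  have h1 := accepts_main (N := 2 * w.length + T + 3) hf hacc (h0 ▸ init_hasTape M w (T + 1))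
    (by rw [List.length_append, List.length_replicate]; omega)
    (by rw [List.length_append, List.length_replicate, length_encode, List.length_nil]; omega)
  rw [h0] at h1
  have h2 := accepts_of_isRotated (N := 2 * w.length + T + 3) (initWord_isRotated _)
    (by rw [(initWord_isRotated _).perm.length_eq, length_word, List.length_append,
      List.length_replicate, length_encode, List.length_nil]; omega) h1
  have h3 := accepts_pad h2
  -- The `start` rule has already recoded the first letter, so copying begins with it as the
  -- finished part.
  have hw : w = w.head?.toList ++ w.tail := by cases w <;> rfl
  rw [hw] at h3
  have h4 := accepts_copy h3
  refine .step (u := []) (.start _) h4 ?_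
  rw [← hw, List.length_append, length_codes]
  have e1 : (initWord (encode w.head?.toList)).length ≤ 4 := by
    cases w.head? <;> simp [initWord, encode, cells]
  have e2 : fence.length = 7 := rfl
  have e3 : w.tail.length ≤ w.length := by rw [List.length_tail]; omega
  have e4 := Nat.mul_le_mul_right (6 * (2 * w.length + T + 3) + 9) hn
  omega

end Completeness

theorem AcceptsInSpace.mono {M : NTM} {w : List Bool} {S S' : ℕ} (h : M.AcceptsInSpace w S)
    (hS : S ≤ S') : M.AcceptsInSpace w S' :=
  let ⟨n, f, hf, hn⟩ := h
  ⟨n, f, hf, fun i hi => (hn i hi).trans_le hS⟩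

end NTM

theorem kNExpTime_subset_kNExpWOSpace (k : ℕ) : kNExpTime k ⊆ kNExpWOSpace k := by
  intro L hL
  simp only [kNExpTime, Set.mem_iUnion] at hL
  obtain ⟨t, C, M, hrec, hT⟩ := hL
  -- The space used is a quadratic polynomial in time and word length; `200` leaves ample room for
  -- its coefficients.
  obtain ⟨t', C', h⟩ := exists_kexp_bound k t C 200
  simp only [kNExpWOSpace, Set.mem_iUnion]
  have hspace : ∀ w ∈ L, M.toQueueMachine.toNTM.AcceptsInSpace w
      (C' * kexp k (w.length ^ t') + C') := by
    intro w hw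
    refine (hT w hw).toQueueMachine.toNTM.mono (le_trans ?_ (h w.length))
    dsimp only
    generalize C * kexp k (w.length ^ t) + C = T
    generalize w.length = n
    nlinarith [Nat.zero_le (T * n), Nat.zero_le (T * T), Nat.zero_le (n * n)]
  refine ⟨t', C', M.toQueueMachine.toNTM, M.toQueueMachine.toNTM_writeOnce,
    fun w => ⟨fun hw => (hspace w hw).accepts, fun hw => ?_⟩, hspace⟩
  obtain ⟨n, hn⟩ := QueueMachine.exists_accepts_of_toNTM hw
  exact (hrec w).2 (NTM.accepts_of_toQueueMachine hn)

theorem theorem3 (k : ℕ) : kNExpTime k = kNExpWOSpace k :=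
  (kNExpTime_subset_kNExpWOSpace k).antisymm (kNExpWOSpace_subset_kNExpTime k)
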